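/- A fair coin is flipped $n$ times. For each pair of consecutive flips equal to $HH$ Alice gets a point, and for each pair of consecutive flips equal to $HT$ Bob gets a point. Let $P_n(\mathrm{Bob})$ be the probability that Bob has strictly more points than Alice after $n$ flips, let $P_n(\mathrm{Alice})$ be the probability that Alice has strictly more points than Bob, and put $\Delta_n = P_n(\mathrm{Bob}) - P_n(\mathrm{Alice})$. Then, as $n \to \infty$, $$\Delta_n = \frac{1}{2\sqrt{n\pi}} + O\left(n^{-3/2}\right).$$ -/

import Mathlib

open Filter Asymptotics MeasureTheory ProbabilityTheory

namespace CoinGame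

/-- The outcome of `n` coin flips; `true` is heads, `false` is tails. -/
abbrev Flips (n : ℕ) : Type := Fin n → Bool

/-- Alice's score: the number of pairs of consecutive flips `HH`. -/
def aliceScore {n : ℕ} (x : Flips n) : ℕ :=
  (Finset.univ.filter fun p : Fin n × Fin n =>
    (p.2 : ℕ) = (p.1 : ℕ) + 1 ∧ x p.1 = true ∧ x p.2 = true).card

/-- Bob's score: the number of pairs of consecutive flips `HT`. -/
def bobScore {n : ℕ} (x : Flips n) : ℕ :=
  (Finset.univ.filter fun p : Fin n × Fin n =>
    (p.2 : ℕ) = (p.1 : ℕ) + 1 ∧ x p.1 = true ∧ x p.2 = false).card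

/-- The law of `n` independent flips of a fair coin: the uniform probability measure on
`{H, T}ⁿ`. -/
noncomputable def coinMeasure (n : ℕ) : Measure (Flips n) := uniformOn Set.univ

/-- The probability that Bob has strictly more points than Alice after `n` flips. -/
noncomputable def probBob (n : ℕ) : ℝ :=
  (coinMeasure n).real {x | aliceScore x < bobScore x}

/-- The probability that Alice has strictly more points than Bob after `n` flips. -/
noncomputable def probAlice (n : ℕ) : ℝ :=
  (coinMeasure n).real {x | bobScore x < aliceScore x}

/-- The difference `Δ_n` of the win probabilities. -/
noncomputable def winDiff (n : ℕ) : ℝ := probBob n - probAlice n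

end CoinGame

/-! Split sequences by last flip and Alice's lead d. Away from d = 0 the recurrence for `headCount`
has coefficients independent of d, so the kernel method makes its generating functions geometric in
d on each side of 0. A relation between the two ratios gives `winCount n = headCount n (-1)`, and
hence (`winCount_eq_coeff`) the series of 2 * `winCount n` + 1 is ((1 - X)(1 - X - 4X³))^(-1/2).

Since 1 - X - 4X³ = (1 - 2X)(1 + X + 2X²), rescaling X by 1/2 turns this into (1 - X)^(-1/2) times a
factor whose coefficients decay geometrically and whose value at 1 is 1
(`valueAtOne_regularFactor`). Thus 2Δ_n is C(2n, n)/4ⁿ up to O(n^(-3/2)) by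
`norm_coeff_invSqrtSeries_one_mul_sub_le`, and Wallis' product (`abs_binomRatio_sub_le`) finishes.
-/

namespace CoinGame

/-! ### Recurrences for the counts -/

/-- The last flip is heads (for the empty sequence: `false`). -/
def lastFlip : {n : ℕ} → Flips n → Bool
  | 0, _ => false
  | n + 1, x => x (Fin.last n)

/-- Alice's lead over Bob. -/
def lead {n : ℕ} (x : Flips n) : ℤ := (aliceScore x : ℤ) - bobScore x

/-- Appending a flip creates at most one new consecutive pair. -/
theorem card_pairs_snoc (n : ℕ) (x : Flips n) (b c : Bool) :
    (Finset.univ.filter fun p : Fin (n + 1) × Fin (n + 1) =>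
      (p.2 : ℕ) = (p.1 : ℕ) + 1 ∧ Fin.snoc (α := fun _ => Bool) x b p.1 = true ∧
        Fin.snoc (α := fun _ => Bool) x b p.2 = c).card =
    (Finset.univ.filter fun p : Fin n × Fin n =>
      (p.2 : ℕ) = (p.1 : ℕ) + 1 ∧ x p.1 = true ∧ x p.2 = c).card +
      if lastFlip x = true ∧ b = c then 1 else 0 := by
  simp only [Finset.card_filter, Fintype.sum_prod_type]
  rw [Fin.sum_univ_castSucc]
  simp only [Fin.sum_univ_castSucc, Fin.snoc_castSucc, Fin.snoc_last, Fin.val_castSucc,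
    Fin.val_last, Finset.sum_add_distrib]
  have h1 : ∀ j : Fin n, ¬ ((j : ℕ) = n + 1) := fun j => by omega
  have h2 : ¬ (n = n + 1) := by omega
  simp only [h1, h2, false_and, if_false, Finset.sum_const_zero, add_zero]
  congr 1
  -- The only new pair joins the old last flip to `b`; for n = 0 there is none, which the default
  -- `false` of `lastFlip` encodes.
  cases n with
  | zero => simp [lastFlip]
  | succ n =>
    rw [Fin.sum_univ_castSucc]
    have h3 : ∀ j : Fin n, ¬ (n = (j : ℕ)) := fun j => by omega
    simp only [lastFlip, Fin.val_castSucc, Fin.val_last, Nat.add_right_cancel_iff, h3,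
      false_and, if_false, Finset.sum_const_zero, zero_add, true_and]
    congr

theorem lastFlip_snoc (n : ℕ) (x : Flips n) (b : Bool) :
    lastFlip (Fin.snoc (α := fun _ => Bool) x b : Flips (n + 1)) = b := by
  simp [lastFlip]

theorem lead_snoc (n : ℕ) (x : Flips n) (b : Bool) :
    lead (Fin.snoc (α := fun _ => Bool) x b : Flips (n + 1)) =
      lead x + if lastFlip x then (if b then 1 else -1) else 0 := by
  unfold lead aliceScore bobScore
  rw [card_pairs_snoc, card_pairs_snoc]
  cases b <;> cases lastFlip x <;> simp <;> ring

/-- The sum over all flip sequences of a function of the last flip and the lead. -/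
def flipSum (n : ℕ) (φ : Bool → ℤ → ℤ) : ℤ := ∑ x : Flips n, φ (lastFlip x) (lead x)

theorem flipSum_zero (φ : Bool → ℤ → ℤ) : flipSum 0 φ = φ false 0 := by
  simp [flipSum, lastFlip, lead, aliceScore, bobScore]

theorem flipSum_succ (n : ℕ) (φ : Bool → ℤ → ℤ) :
    flipSum (n + 1) φ = flipSum n fun b d =>
      if b then φ true (d + 1) + φ false (d - 1) else φ true d + φ false d := by
  unfold flipSum
  rw [← (Fin.snocEquiv fun _ : Fin (n + 1) => Bool).sum_comp, Fintype.sum_prod_type,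
    Fintype.sum_bool, ← Finset.sum_add_distrib]
  refine Finset.sum_congr rfl fun x _ => ?_
  simp only [Fin.snocEquiv, Equiv.coe_fn_mk, lastFlip_snoc, lead_snoc]
  cases lastFlip x <;> simp [sub_eq_add_neg]

/-- The number of sequences of `n` flips ending in heads at which Alice leads by `d`. -/
def headCount (n : ℕ) (d : ℤ) : ℤ := flipSum n fun b e => if b ∧ e = d then 1 else 0

/-- The number of sequences of `n` flips not ending in heads at which Alice leads by `d`. -/
def tailCount (n : ℕ) (d : ℤ) : ℤ := flipSum n fun b e => if ¬ b ∧ e = d then 1 else 0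

theorem headCount_succ (n : ℕ) (d : ℤ) :
    headCount (n + 1) d = headCount n (d - 1) + tailCount n d := by
  rw [headCount, flipSum_succ]
  simp only [headCount, tailCount, flipSum, ← Finset.sum_add_distrib]
  refine Finset.sum_congr rfl fun x _ => ?_
  cases lastFlip x <;> simp [eq_sub_iff_add_eq]

theorem tailCount_succ (n : ℕ) (d : ℤ) :
    tailCount (n + 1) d = headCount n (d + 1) + tailCount n d := by
  rw [tailCount, flipSum_succ]
  simp only [headCount, tailCount, flipSum, ← Finset.sum_add_distrib]
  refine Finset.sum_congr rfl fun x _ => ?_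
  cases lastFlip x <;> simp [sub_eq_iff_eq_add]

theorem headCount_zero (d : ℤ) : headCount 0 d = 0 := by
  simp [headCount, flipSum_zero]

theorem headCount_one (d : ℤ) : headCount 1 d = if d = 0 then 1 else 0 := by
  rw [headCount_succ, headCount_zero, tailCount, flipSum_zero]
  simp [eq_comm]

/-- Eliminates `tailCount` from the two one-step recurrences. -/
theorem headCount_add_two (n : ℕ) (d : ℤ) :
    headCount (n + 2) d = headCount (n + 1) d + headCount (n + 1) (d - 1) +
      headCount n (d + 1) - headCount n (d - 1) := by
  have h1 := headCount_succ (n + 1) d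
  have h2 := tailCount_succ n d
  have h3 := headCount_succ n d
  linarith

/-- The number of sequences won by Bob minus the number of sequences won by Alice. -/
def winCount (n : ℕ) : ℤ := flipSum n fun _ d => -d.sign

theorem winCount_zero : winCount 0 = 0 := by simp [winCount, flipSum_zero]

/-- The second difference of the sign lives at d = ±1, so only leads ±1 enter `winCount_succ`. -/
theorem sign_add_one_add_sign_sub_one (d : ℤ) :
    (d + 1).sign + (d - 1).sign =
      2 * d.sign - (if d = 1 then 1 else 0) + if d = -1 then 1 else 0 := by
  rcases lt_trichotomy d 0 with h | rfl | h
  · rcases eq_or_ne d (-1) with rfl | h'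
    · simp
    · rw [Int.sign_eq_neg_one_of_neg h, Int.sign_eq_neg_one_of_neg (by omega : d - 1 < 0),
        Int.sign_eq_neg_one_of_neg (by omega : d + 1 < 0), if_neg (by omega), if_neg h']
      norm_num
  · simp
  · rcases eq_or_ne d 1 with rfl | h'
    · simp
    · rw [Int.sign_eq_one_of_pos h, Int.sign_eq_one_of_pos (by omega : 0 < d - 1),
        Int.sign_eq_one_of_pos (by omega : 0 < d + 1), if_neg h', if_neg (by omega)]
      norm_num

theorem winCount_succ (n : ℕ) :
    winCount (n + 1) = 2 * winCount n + headCount n 1 - headCount n (-1) := by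
  rw [winCount, flipSum_succ]
  simp only [winCount, headCount, flipSum, Finset.mul_sum, ← Finset.sum_add_distrib,
    ← Finset.sum_sub_distrib]
  refine Finset.sum_congr rfl fun x _ => ?_
  have := sign_add_one_add_sign_sub_one (lead x)
  cases lastFlip x
  · simp; ring
  · simp only [if_true, true_and]; linarith

/-! ### From probabilities to counts -/

theorem coinMeasure_real (n : ℕ) (s : Set (Flips n)) [DecidablePred (· ∈ s)] :
    (coinMeasure n).real s = (∑ x : Flips n, if x ∈ s then 1 else 0) / 2 ^ n := by
  rw [coinMeasure, Measure.real, uniformOn_univ, ENNReal.toReal_div]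
  congr 1
  · rw [Measure.count_apply s.toFinite.measurableSet, Set.encard_eq_coe_toFinset_card]
    simp [Set.toFinset_card, Fintype.card_subtype]
  · simp

theorem winDiff_eq (n : ℕ) : winDiff n = winCount n / 2 ^ n := by
  rw [winDiff, probBob, probAlice, coinMeasure_real, coinMeasure_real, ← sub_div,
    ← Finset.sum_sub_distrib, winCount, flipSum]
  push_cast
  congr 1
  refine Finset.sum_congr rfl fun x _ => ?_
  simp only [Set.mem_ofPred_eq, lead]
  rcases lt_trichotomy (aliceScore x) (bobScore x) with h | h | h
  · rw [if_pos h, if_neg (by omega), Int.sign_eq_neg_one_of_neg (by omega)]; norm_num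
  · simp [h]
  · rw [if_neg (by omega), if_pos h, Int.sign_eq_one_of_pos (by omega)]; norm_num

/-! ### Inverse square root series -/

open PowerSeries

/-- The probability `C(2n, n) / 4ⁿ` that `2n` fair flips are balanced. -/
noncomputable def binomRatio (n : ℕ) : ℝ := (n.centralBinom : ℝ) / 4 ^ n

theorem binomRatio_zero : binomRatio 0 = 1 := by simp [binomRatio]

theorem binomRatio_pos (n : ℕ) : 0 < binomRatio n :=
  div_pos (by exact_mod_cast n.centralBinom_pos) (by positivity)

theorem binomRatio_succ (n : ℕ) :
    2 * (n + 1) * binomRatio (n + 1) = (2 * n + 1) * binomRatio n := by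
  have h : ((n : ℝ) + 1) * (n + 1).centralBinom = 2 * (2 * n + 1) * n.centralBinom := by
    exact_mod_cast n.succ_mul_centralBinom_succ
  simp only [binomRatio, pow_succ]
  field_simp
  linarith

/-- The power series of `(1 - c x)^(-1/2)`. -/
noncomputable def invSqrtSeries (c : ℂ) : ℂ⟦X⟧ := mk fun n => (binomRatio n : ℂ) * c ^ n

theorem constantCoeff_invSqrtSeries (c : ℂ) : constantCoeff (invSqrtSeries c) = 1 := by
  rw [← coeff_zero_eq_constantCoeff_apply, invSqrtSeries, coeff_mk, binomRatio_zero]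
  simp

/-- The differential equation 2(1 - cX)f' = cf is `binomRatio_succ` read coefficientwise; it makes
the derivative of f²(1 - cX) vanish. -/
theorem derivative_invSqrtSeries (c : ℂ) :
    2 * d⁄dX ℂ (invSqrtSeries c) =
      C c * invSqrtSeries c + 2 * C c * (X * d⁄dX ℂ (invSqrtSeries c)) := by
  have h2 : (2 : ℂ⟦X⟧) = C (2 : ℂ) := (map_ofNat C 2).symm
  rw [h2, ← map_mul]
  ext n
  have hb : (2 : ℂ) * (n + 1) * binomRatio (n + 1) = (2 * n + 1) * binomRatio n := by
    exact_mod_cast binomRatio_succ n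
  have hX : coeff n (X * d⁄dX ℂ (invSqrtSeries c)) = n * ((binomRatio n : ℂ) * c ^ n) := by
    cases n with
    | zero => simp
    | succ n =>
      rw [coeff_succ_X_mul, coeff_derivative, invSqrtSeries, coeff_mk]
      push_cast
      ring
  rw [map_add, coeff_C_mul, coeff_C_mul, coeff_C_mul, hX, coeff_derivative, invSqrtSeries,
    coeff_mk, coeff_mk, pow_succ]
  linear_combination c ^ n * c * hb

theorem invSqrtSeries_sq (c : ℂ) : invSqrtSeries c ^ 2 * (1 - C c * X) = 1 := by
  apply derivative.ext
  · have h := derivative_invSqrtSeries c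
    simp only [Derivation.leibniz, Derivation.leibniz_pow, map_sub, derivative_C, derivative_X,
      smul_eq_mul, Derivation.map_one_eq_zero, nsmul_eq_mul]
    push_cast
    linear_combination invSqrtSeries c * h
  · simp [constantCoeff_invSqrtSeries]

theorem rescale_invSqrtSeries (a c : ℂ) :
    rescale a (invSqrtSeries c) = invSqrtSeries (a * c) := by
  ext n
  simp only [invSqrtSeries, coeff_rescale, coeff_mk]
  ring

/-! ### Kernel method -/

/-- The recurrence of `headCount` determines its generating functions. -/
theorem coeff_eq_headCount (E : ℤ → ℂ⟦X⟧)
    (hE : ∀ d, E d = X * E d + X * E (d - 1) - X * (X * E (d - 1)) + X * (X * E (d + 1)) +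
      if d = 0 then X else 0) (n : ℕ) :
    ∀ d, coeff n (E d) = headCount n d := by
  induction n using Nat.twoStepInduction with
  | zero =>
    intro d
    rw [hE, headCount_zero]
    split_ifs <;> simp
  | one =>
    intro d
    have h0 : ∀ d, constantCoeff (E d) = 0 := fun d => by
      rw [hE]
      split_ifs <;> simp
    rw [hE, headCount_one]
    split_ifs <;> simp [h0]
  | more n ih0 ih1 =>
    intro d
    have hX : coeff (n + 2) (if d = 0 then X else 0 : ℂ⟦X⟧) = 0 := by
      split_ifs <;> simp [coeff_X]
    rw [hE, map_add, hX, headCount_add_two]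
    simp only [map_add, map_sub, coeff_succ_X_mul, ih0, ih1]
    push_cast
    ring

section GeneratingFunction

variable {Y : ℂ⟦X⟧}

/-- The small root of the kernel of the generating function equation. -/
theorem exists_kernel_root (hY : Y ^ 2 * ((1 - X) * (1 - X - 4 * X ^ 3)) = 1)
    (h0 : constantCoeff Y = 1) :
    ∃ ρ : ℂ⟦X⟧, Y * (1 - X - 2 * X ^ 2 * ρ) = 1 ∧
      X * (1 - X) - (1 - X) * ρ + X ^ 2 * ρ ^ 2 = 0 := by
  set T : ℂ⟦X⟧ := (1 - X) * (1 - X - 4 * X ^ 3) * Y with hT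
  have hTY : Y * T = 1 := by rw [hT]; linear_combination hY
  have hT2 : T ^ 2 = (1 - X) * (1 - X - 4 * X ^ 3) := by
    rw [hT]; linear_combination (1 - X) * (1 - X - 4 * X ^ 3) * hY
  -- The root (1 - X - T)/(2X²) is rationalised to 2X(1 - X)/S, which is a power series because S
  -- has constant term 2.
  set S := T + (1 - X) with hS
  have hS0 : constantCoeff S ≠ 0 := by
    rw [hS, hT]
    simp [h0]
  have hSi : S * S⁻¹ = 1 := PowerSeries.mul_inv_cancel S hS0
  have hρ : 1 - X - 2 * X ^ 2 * (2 * X * (1 - X) * S⁻¹) = T := by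
    have hSne : S ≠ 0 := fun h => hS0 (by rw [h, map_zero])
    apply mul_right_cancel₀ hSne
    rw [hS] at hSi ⊢
    linear_combination (-4 * X ^ 3 * (1 - X)) * hSi - hT2
  refine ⟨2 * X * (1 - X) * S⁻¹, by rw [hρ, hTY], ?_⟩
  set ρ := 2 * X * (1 - X) * S⁻¹
  have h4 : (4 * X ^ 2 : ℂ⟦X⟧) ≠ 0 := by
    rw [show (4 : ℂ⟦X⟧) = C (4 : ℂ) from (map_ofNat C 4).symm]
    exact mul_ne_zero (by simp) (pow_ne_zero _ X_ne_zero)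
  apply mul_left_cancel₀ h4
  linear_combination hT2 + (- T - (1 - X - 2 * X ^ 2 * ρ)) * (- hρ)

theorem winCount_eq_coeff (hY : Y ^ 2 * ((1 - X) * (1 - X - 4 * X ^ 3)) = 1)
    (h0 : constantCoeff Y = 1) (n : ℕ) : 2 * (winCount n : ℂ) + 1 = coeff n Y := by
  obtain ⟨ρ, h1, h2⟩ := exists_kernel_root hY h0
  have hu : (mk 1 : ℂ⟦X⟧) * (1 - X) = 1 := mk_one_mul_one_sub_eq_one ℂ
  -- The kernel roots have product (1 - X)/X, so r = Xρ/(1 - X) is the reciprocal of the other root,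
  -- the ratio for negative leads. The equation at d = 0 fixes the prefactor `X * Y`.
  set r : ℂ⟦X⟧ := X * ρ * mk 1 with hr
  have hr1 : (1 - X) * r = X * ρ := by rw [hr]; linear_combination X * ρ * hu
  have hr2 : (1 - X) * r - X * (1 - X) * r ^ 2 - X ^ 2 = 0 := by
    apply mul_left_cancel₀ (right_ne_zero_of_mul_eq_one hu)
    linear_combination (1 - X - X * (1 - X) * r - X * (X * ρ)) * hr1 - X * h2
  let E : ℤ → ℂ⟦X⟧
    | Int.ofNat k => X * Y * ρ ^ k
    | Int.negSucc k => X * Y * r ^ (k + 1)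
  have hE : ∀ n d, coeff n (E d) = headCount n d := fun n d => by
    refine coeff_eq_headCount E (fun d => ?_) n d
    rcases d with k | k
    · cases k with
      | zero =>
        change X * Y * ρ ^ 0 = X * (X * Y * ρ ^ 0) + X * (X * Y * r ^ 1) -
          X * (X * (X * Y * r ^ 1)) + X * (X * (X * Y * ρ ^ 1)) + X
        linear_combination X * h1 - X ^ 2 * Y * hr1
      | succ k =>
        have e1 : Int.ofNat (k + 1) - 1 = Int.ofNat k := by simp
        have e2 : Int.ofNat (k + 1) + 1 = Int.ofNat (k + 2) := by simp; ring
        rw [e1, e2, if_neg (by simp; omega)]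
        change X * Y * ρ ^ (k + 1) = X * (X * Y * ρ ^ (k + 1)) + X * (X * Y * ρ ^ k) -
          X * (X * (X * Y * ρ ^ k)) + X * (X * (X * Y * ρ ^ (k + 2))) + 0
        linear_combination (-X * Y * ρ ^ k) * h2
    · have e1 : Int.negSucc k - 1 = Int.negSucc (k + 1) := rfl
      rw [e1, if_neg (Int.negSucc_ne_zero k)]
      have e2 : E (Int.negSucc k + 1) = X * Y * r ^ k := by
        cases k with
        | zero =>
          change X * Y * ρ ^ 0 = X * Y * r ^ 0
          simp
        | succ k => rfl
      rw [e2]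
      change X * Y * r ^ (k + 1) = X * (X * Y * r ^ (k + 1)) + X * (X * Y * r ^ (k + 2)) -
          X * (X * (X * Y * r ^ (k + 2))) + X * (X * (X * Y * r ^ k)) + 0
      linear_combination (X * Y * r ^ k) * hr2
  have hE1 : E (-1) = X * Y * r := by
    change X * Y * r ^ 1 = _
    rw [pow_one]
  have hE2 : E 1 = X * Y * ρ := by
    change X * Y * ρ ^ 1 = _
    rw [pow_one]
  -- From (1 - X)r = Xρ; this turns `winCount_succ` into the recurrence of `headCount · (-1)`.
  have hrefl : ∀ n, headCount (n + 1) (-1) = headCount n (-1) + headCount n 1 := fun n => by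
    have h : E (-1) = X * E (-1) + X * E 1 := by
      rw [hE1, hE2]
      linear_combination X * Y * hr1
    have := congrArg (coeff (n + 1)) h
    rw [map_add, coeff_succ_X_mul, coeff_succ_X_mul, hE, hE n (-1), hE n 1] at this
    exact_mod_cast this
  have hW : ∀ n, winCount n = headCount n (-1) := fun n => by
    induction n with
    | zero => rw [winCount_zero, headCount_zero]
    | succ n ih => rw [winCount_succ, hrefl, ih]; ring
  have hsum : C (2 : ℂ) * E (-1) + mk 1 = Y := by
    rw [hE1, map_ofNat]
    apply mul_left_cancel₀ (right_ne_zero_of_mul_eq_one hu)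
    linear_combination hu - h1 + 2 * X * Y * hr1
  rw [← hsum, map_add, coeff_C_mul, hE, hW, coeff_mk, Pi.one_apply]

end GeneratingFunction

/-! ### Estimates for the central binomial ratio -/

theorem binomRatio_le (n : ℕ) : binomRatio n ≤ ((n : ℝ) + 1) ^ (-(1 / 2) : ℝ) := by
  have key : ∀ n : ℕ, binomRatio n ^ 2 * (n + 1) ≤ 1 := fun n => by
    induction n with
    | zero => simp [binomRatio_zero]
    | succ n ih =>
      have h := binomRatio_succ n
      have hn : (0 : ℝ) < 2 * (n + 1) := by positivity
      have e : binomRatio (n + 1) = (2 * n + 1) * binomRatio n / (2 * (n + 1)) := by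
        rw [← h]; field_simp
      have h2 : binomRatio (n + 1) ^ 2 * ((n + 1 : ℕ) + 1) =
          binomRatio n ^ 2 * ((2 * n + 1) ^ 2 * (n + 2)) / (2 * (n + 1)) ^ 2 := by
        rw [e, div_pow, mul_pow]; push_cast; ring
      rw [h2, div_le_one (by positivity)]
      have h3 : ((2 * n + 1) ^ 2 * (n + 2) : ℝ) ≤ (n + 1) * (2 * (n + 1)) ^ 2 := by
        have : (0 : ℝ) ≤ n := n.cast_nonneg
        linarith
      calc binomRatio n ^ 2 * ((2 * n + 1) ^ 2 * (n + 2))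
          ≤ binomRatio n ^ 2 * ((n + 1) * (2 * (n + 1)) ^ 2) := by gcongr
        _ = binomRatio n ^ 2 * (n + 1) * (2 * (n + 1)) ^ 2 := by ring
        _ ≤ 1 * (2 * (n + 1)) ^ 2 := by gcongr
        _ = _ := one_mul _
  have hn : (0 : ℝ) < n + 1 := by positivity
  rw [Real.rpow_neg hn.le, ← Real.sqrt_eq_rpow, ← one_div, le_div_iff₀ (Real.sqrt_pos.2 hn)]
  refine (sq_le_one_iff₀ (by have := (binomRatio_pos n).le; positivity)).1 ?_
  rw [mul_pow, Real.sq_sqrt hn.le]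
  exact key n

theorem binomRatio_le_one (n : ℕ) : binomRatio n ≤ 1 :=
  (binomRatio_le n).trans (Real.rpow_le_one_of_one_le_of_nonpos (by simp) (by norm_num))

/-- The error scale `(n + 1)^(-3/2)`. -/
noncomputable def errScale (n : ℕ) : ℝ := ((n : ℝ) + 1) ^ (-(3 / 2) : ℝ)

theorem errScale_pos (n : ℕ) : 0 < errScale n := Real.rpow_pos_of_pos (by positivity) _

theorem errScale_antitone : Antitone errScale := fun m n h =>
  Real.rpow_le_rpow_of_nonpos (by positivity) (by gcongr) (by norm_num)

theorem one_le_mul_errScale (n : ℕ) : 1 ≤ ((n : ℝ) + 1) ^ 2 * errScale n := by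
  rw [errScale, ← Real.rpow_natCast, ← Real.rpow_add (by positivity)]
  exact Real.one_le_rpow (by simp) (by norm_num)

/-- Since m + j + 1 ≤ (m + 1)(j + 1), shifting the index by j costs only a polynomial factor in j.
-/
theorem errScale_le_mul (m j : ℕ) : errScale m ≤ ((j : ℝ) + 1) ^ 2 * errScale (m + j) := by
  have h : errScale m * errScale j ≤ errScale (m + j) := by
    rw [errScale, errScale, errScale, ← Real.mul_rpow (by positivity) (by positivity)]
    refine Real.rpow_le_rpow_of_nonpos (by positivity) ?_ (by norm_num)
    push_cast
    nlinarith [mul_nonneg m.cast_nonneg (α := ℝ) j.cast_nonneg]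
  calc errScale m = errScale m * 1 := (mul_one _).symm
    _ ≤ errScale m * (((j : ℝ) + 1) ^ 2 * errScale j) :=
      mul_le_mul_of_nonneg_left (one_le_mul_errScale j) (errScale_pos m).le
    _ = ((j : ℝ) + 1) ^ 2 * (errScale m * errScale j) := by ring
    _ ≤ _ := mul_le_mul_of_nonneg_left h (by positivity)

theorem binomRatio_sub_succ (n : ℕ) :
    binomRatio (n + 1) ≤ binomRatio n ∧ binomRatio n - binomRatio (n + 1) ≤ errScale n := by
  have h := binomRatio_succ n
  have hp := binomRatio_pos n
  have hn : (0 : ℝ) < n + 1 := by positivity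
  have e : binomRatio n - binomRatio (n + 1) = binomRatio n / (2 * (n + 1)) := by
    field_simp; linarith
  have he : errScale n = ((n : ℝ) + 1) ^ (-(1 / 2) : ℝ) / (n + 1) := by
    rw [errScale, ← Real.rpow_sub_one hn.ne']
    norm_num
  constructor
  · have : 0 < binomRatio n / (2 * (n + 1)) := by positivity
    linarith
  · rw [e, he]
    have := binomRatio_le n
    gcongr
    linarith

/-- Telescoping costs one factor j and moving the scale from m to m + j costs two more, hence the
cube. -/
theorem binomRatio_sub_add (m j : ℕ) :
    |binomRatio m - binomRatio (m + j)| ≤ ((j : ℝ) + 1) ^ 3 * errScale (m + j) := by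
  have h : 0 ≤ binomRatio m - binomRatio (m + j) ∧
      binomRatio m - binomRatio (m + j) ≤ j * errScale m := by
    induction j with
    | zero => simp
    | succ j ih =>
      have h1 := binomRatio_sub_succ (m + j)
      have h2 := errScale_antitone (Nat.le_add_right m j)
      rw [← add_assoc]
      push_cast
      constructor <;> linarith
  rw [abs_of_nonneg h.1]
  calc _ ≤ (j : ℝ) * errScale m := h.2
    _ ≤ (j + 1) * (((j : ℝ) + 1) ^ 2 * errScale (m + j)) :=
      mul_le_mul (by linarith) (errScale_le_mul m j) (errScale_pos m).le (by positivity)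
    _ = _ := by ring

theorem binomRatio_sq_mul_W (n : ℕ) :
    binomRatio n ^ 2 * (2 * n + 1) * Real.Wallis.W n = 1 := by
  have h : ((n.centralBinom : ℝ)) * (n.factorial * n.factorial) = (2 * n).factorial := by
    rw [Nat.centralBinom_eq_two_mul_choose]
    have := Nat.choose_mul_factorial_mul_factorial (show n ≤ 2 * n by omega)
    rw [show 2 * n - n = n by omega, mul_assoc] at this
    exact_mod_cast this
  have hc : (n.centralBinom : ℝ) ≠ 0 := by exact_mod_cast n.centralBinom_ne_zero
  have hf : (n.factorial : ℝ) ≠ 0 := by exact_mod_cast n.factorial_ne_zero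
  have h4 : (2 : ℝ) ^ (4 * n) = 4 ^ n * 4 ^ n := by
    rw [← mul_pow, pow_mul]; norm_num
  rw [Real.Wallis.W_eq_factorial_ratio, ← h, binomRatio, h4]
  field_simp

theorem abs_binomRatio_sub_le {n : ℕ} (hn : 0 < n) :
    |binomRatio n - 1 / Real.sqrt (n * Real.pi)| ≤ (n : ℝ) ^ (-(3 / 2) : ℝ) := by
  have hn' : (0 : ℝ) < n := by exact_mod_cast hn
  have hπ := Real.pi_pos
  set s := 1 / Real.sqrt (n * Real.pi) with hs
  have hs0 : 0 < s := by positivity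
  have hs2 : s ^ 2 * (n * Real.pi) = 1 := by
    rw [hs, div_pow, Real.sq_sqrt (by positivity)]
    field_simp
  have hb := binomRatio_pos n
  have hW := binomRatio_sq_mul_W n
  have h1 := Real.Wallis.W_le n
  have h2 := Real.Wallis.le_W n
  have hle : binomRatio n ≤ s := by
    refine le_of_sq_le_sq ?_ hs0.le
    have h3 : binomRatio n ^ 2 * (2 * n + 1) * ((2 * n + 1) / (2 * n + 2) * (Real.pi / 2)) ≤ 1 :=
      (mul_le_mul_of_nonneg_left h2 (by positivity)).trans hW.le
    have h4 : binomRatio n ^ 2 * (n * Real.pi) ≤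
        binomRatio n ^ 2 * (2 * n + 1) * ((2 * n + 1) / (2 * n + 2) * (Real.pi / 2)) := by
      have e : binomRatio n ^ 2 * (2 * n + 1) * ((2 * n + 1) / (2 * n + 2) * (Real.pi / 2)) -
          binomRatio n ^ 2 * (n * Real.pi) =
            binomRatio n ^ 2 * Real.pi / (2 * (2 * n + 2)) := by
        field_simp
        ring
      have : 0 ≤ binomRatio n ^ 2 * Real.pi / (2 * (2 * n + 2)) := by positivity
      linarith
    exact le_of_mul_le_mul_right (h4.trans (h3.trans hs2.ge)) (by positivity)
  have hge : s ^ 2 * (2 * n) ≤ binomRatio n ^ 2 * (2 * n + 1) := by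
    have h3 : 1 ≤ binomRatio n ^ 2 * (2 * n + 1) * (Real.pi / 2) :=
      hW.ge.trans (mul_le_mul_of_nonneg_left h1 (by positivity))
    refine le_of_mul_le_mul_right (a := Real.pi / 2) ?_ (by positivity)
    linarith
  have hsn : s ≤ (n : ℝ) ^ (-(1 / 2) : ℝ) := by
    rw [Real.rpow_neg hn'.le, ← Real.sqrt_eq_rpow, ← one_div, hs]
    gcongr
    nlinarith [Real.pi_gt_three]
  -- `hge` gives (s - b)(s + b) · 2n ≤ b² for b = `binomRatio n`; then divide by s + b.
  have hd : (s - binomRatio n) * n ≤ s := by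
    refine le_of_mul_le_mul_right (a := s + binomRatio n) ?_ (by positivity)
    have h3 := mul_le_mul_of_nonneg_left hle hb.le
    have h4 := mul_pos hs0 hb
    have h5 := mul_pos hs0 hs0
    linarith
  rw [abs_sub_comm, abs_of_nonneg (by linarith)]
  have he : (n : ℝ) ^ (-(3 / 2) : ℝ) = (n : ℝ) ^ (-(1 / 2) : ℝ) / n := by
    rw [← Real.rpow_sub_one hn'.ne']
    norm_num
  rw [he, le_div_iff₀ hn']
  exact hd.trans hsn

/-! ### Transfer of coefficient asymptotics -/

/-- The coefficients of a power series are summable against the weight `(n + 1)³`. -/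
def WeightSummable (f : ℂ⟦X⟧) : Prop := Summable fun n : ℕ => ((n : ℝ) + 1) ^ 3 * ‖coeff n f‖

theorem WeightSummable.summable_norm {f : ℂ⟦X⟧} (hf : WeightSummable f) :
    Summable fun n => ‖coeff n f‖ :=
  Summable.of_nonneg_of_le (fun _ => norm_nonneg _)
    (fun n => le_mul_of_one_le_left (norm_nonneg _) (one_le_pow₀ (by simp))) hf

theorem WeightSummable.mul {f g : ℂ⟦X⟧} (hf : WeightSummable f) (hg : WeightSummable g) :
    WeightSummable (f * g) := by
  refine Summable.of_nonneg_of_le (fun _ => by positivity) (fun n => ?_)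
    (summable_sum_mul_antidiagonal_of_summable_mul
      (Summable.mul_of_nonneg hf hg (fun _ => by positivity) fun _ => by positivity))
  rw [coeff_mul]
  refine (mul_le_mul_of_nonneg_left (norm_sum_le _ _) (by positivity)).trans ?_
  rw [Finset.mul_sum]
  refine Finset.sum_le_sum fun p hp => ?_
  rw [norm_mul, mul_mul_mul_comm, ← mul_pow]
  refine mul_le_mul_of_nonneg_right ?_ (by positivity)
  rw [← Finset.HasAntidiagonal.mem_antidiagonal.1 hp]
  push_cast
  gcongr
  nlinarith [mul_nonneg p.1.cast_nonneg (α := ℝ) p.2.cast_nonneg]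

theorem weightSummable_invSqrtSeries {c : ℂ} (hc : ‖c‖ < 1) :
    WeightSummable (invSqrtSeries c) := by
  have h0 := summable_geometric_of_lt_one (norm_nonneg c) hc
  have h3 := summable_pow_mul_geometric_of_norm_lt_one 3 (r := ‖c‖) (by simpa using hc)
  refine Summable.of_nonneg_of_le (fun _ => by positivity) (fun n => ?_)
    ((h0.add h3).mul_left 4)
  have hb : ‖coeff n (invSqrtSeries c)‖ ≤ ‖c‖ ^ n := by
    rw [invSqrtSeries, coeff_mk, norm_mul, norm_pow, Complex.norm_real,
      Real.norm_of_nonneg (binomRatio_pos n).le]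
    exact mul_le_of_le_one_left (by positivity) (binomRatio_le_one n)
  have hn : ((n : ℝ) + 1) ^ 3 ≤ 4 * (1 + n ^ 3) := by
    have : (0 : ℝ) ≤ n := n.cast_nonneg
    nlinarith [mul_nonneg (add_nonneg this zero_le_one) (sq_nonneg ((n : ℝ) - 1))]
  calc _ ≤ 4 * (1 + (n : ℝ) ^ 3) * ‖c‖ ^ n := mul_le_mul hn hb (norm_nonneg _) (by positivity)
    _ = _ := by ring

/-- The value at `1` of a power series. -/
noncomputable def valueAtOne (f : ℂ⟦X⟧) : ℂ := ∑' n, coeff n f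

theorem valueAtOne_mul {f g : ℂ⟦X⟧} (hf : WeightSummable f) (hg : WeightSummable g) :
    valueAtOne (f * g) = valueAtOne f * valueAtOne g := by
  rw [valueAtOne, valueAtOne, valueAtOne,
    tsum_mul_tsum_eq_tsum_sum_antidiagonal_of_summable_norm hf.summable_norm hg.summable_norm]
  simp only [coeff_mul]

/-- The square of the series is geometric, so its value at 1 is 1/(1 - c). -/
theorem valueAtOne_invSqrtSeries_sq {c : ℂ} (hc : ‖c‖ < 1) :
    valueAtOne (invSqrtSeries c) ^ 2 * (1 - c) = 1 := by
  have h := invSqrtSeries_sq c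
  have hg : (mk fun n => c ^ n : ℂ⟦X⟧) * (1 - C c * X) = 1 := by
    ext n
    rw [mul_sub, mul_one, ← mul_assoc, map_sub]
    cases n with
    | zero => simp
    | succ n =>
      rw [coeff_succ_mul_X, mul_comm _ (C c), coeff_C_mul]
      simp [pow_succ', coeff_one]
  have he : invSqrtSeries c * invSqrtSeries c = mk fun n => c ^ n := by
    apply mul_right_cancel₀ (right_ne_zero_of_mul_eq_one hg)
    rw [hg, ← sq, h]
  rw [sq, ← valueAtOne_mul (weightSummable_invSqrtSeries hc) (weightSummable_invSqrtSeries hc),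
    he, valueAtOne]
  simp only [coeff_mk]
  rw [tsum_geometric_of_norm_lt_one hc, inv_mul_cancel₀]
  rintro h
  rw [← sub_eq_zero.1 h, norm_one] at hc
  exact lt_irrefl _ hc

/-- The difference is the sum over j of f_j (b_{n-j} - b_n) with b_k = 0 for k < 0; each bracket is
at most (j + 1)³ times `errScale n`. -/
theorem norm_coeff_invSqrtSeries_one_mul_sub_le {f : ℂ⟦X⟧} (hf : WeightSummable f) (n : ℕ) :
    ‖coeff n (invSqrtSeries 1 * f) - binomRatio n * valueAtOne f‖ ≤
      (∑' j : ℕ, ((j : ℝ) + 1) ^ 3 * ‖coeff j f‖) * errScale n := by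
  let w : ℕ → ℂ := fun j => if j ≤ n then (binomRatio (n - j) : ℂ) else 0
  have h1 : HasSum (fun j => coeff j f * w j) (coeff n (invSqrtSeries 1 * f)) := by
    have e : coeff n (invSqrtSeries 1 * f) = ∑ j ∈ Finset.range (n + 1), coeff j f * w j := by
      rw [mul_comm, coeff_mul, Finset.Nat.sum_antidiagonal_eq_sum_range_succ_mk]
      refine Finset.sum_congr rfl fun j hj => ?_
      simp only [w, invSqrtSeries, coeff_mk, one_pow, mul_one]
      rw [if_pos (by simpa [Nat.lt_succ_iff] using hj)]
    rw [e]
    refine hasSum_sum_of_ne_finset_zero fun j hj => ?_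
    simp only [w]
    rw [if_neg (by simpa [Nat.lt_succ_iff] using hj), mul_zero]
  have h2 : HasSum (fun j => coeff j f * binomRatio n) (binomRatio n * valueAtOne f) := by
    rw [mul_comm]
    exact hf.summable_norm.of_norm.hasSum.mul_right _
  have h3 := h1.sub h2
  rw [← h3.tsum_eq, ← tsum_mul_right]
  refine tsum_of_norm_bounded (hf.mul_right (errScale n)).hasSum fun j => ?_
  rw [← mul_sub, norm_mul, mul_comm (_ ^ 3), mul_assoc]
  refine mul_le_mul_of_nonneg_left ?_ (norm_nonneg _)
  simp only [w]
  split_ifs with hj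
  · rw [← Complex.ofReal_sub, Complex.norm_real, Real.norm_eq_abs]
    have := binomRatio_sub_add (n - j) j
    rwa [Nat.sub_add_cancel hj] at this
  -- For j > n the bracket is -b_n, at most 1, and the weight (j + 1)³ alone outweighs 1/`errScale
  -- n`.
  · rw [zero_sub, norm_neg, Complex.norm_real, Real.norm_of_nonneg (binomRatio_pos n).le]
    refine (binomRatio_le_one n).trans ((one_le_mul_errScale n).trans ?_)
    refine mul_le_mul_of_nonneg_right ?_ (errScale_pos n).le
    calc ((n : ℝ) + 1) ^ 2 ≤ ((j : ℝ) + 1) ^ 2 := by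
          have : (n : ℝ) ≤ j := by exact_mod_cast (not_le.1 hj).le
          gcongr
      _ ≤ ((j : ℝ) + 1) ^ 3 := pow_le_pow_right₀ (by simp) (by norm_num)

/-! ### The remaining singularities -/

/-- The inverse of a root of `1 + z / 2 + z² / 2`. -/
noncomputable def singularPoint : ℂ := ⟨-1 / 4, Real.sqrt 7 / 4⟩

theorem singularPoint_add_conj : singularPoint + star singularPoint = -1 / 2 := by
  apply Complex.ext <;> simp [singularPoint]
  norm_num

theorem singularPoint_mul_conj : singularPoint * star singularPoint = 1 / 2 := by
  have h : Real.sqrt 7 * Real.sqrt 7 = 7 := Real.mul_self_sqrt (by norm_num)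
  apply Complex.ext <;> simp [singularPoint]
  · linarith
  · ring

theorem norm_singularPoint_lt_one : ‖singularPoint‖ < 1 := by
  have h := congrArg (‖·‖) singularPoint_mul_conj
  simp only [norm_mul, norm_star] at h
  norm_num at h
  nlinarith [norm_nonneg singularPoint]

/-- The factor of the generating function that is regular at the dominant singularity. -/
noncomputable def regularFactor : ℂ⟦X⟧ :=
  invSqrtSeries (1 / 2) * (invSqrtSeries singularPoint * invSqrtSeries (star singularPoint))

theorem weightSummable_regularFactor : WeightSummable regularFactor :=
  (weightSummable_invSqrtSeries (by norm_num)).mul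
    ((weightSummable_invSqrtSeries norm_singularPoint_lt_one).mul
      (weightSummable_invSqrtSeries (by rw [norm_star]; exact norm_singularPoint_lt_one)))

theorem valueAtOne_invSqrtSeries_star (c : ℂ) :
    valueAtOne (invSqrtSeries (star c)) = star (valueAtOne (invSqrtSeries c)) := by
  rw [valueAtOne, valueAtOne, tsum_star]
  refine tsum_congr fun n => ?_
  simp [invSqrtSeries]

/-- The square is 1 because (1 - 1/2) · 2 = 1; the sign is settled by writing the value as a
nonnegative real times a squared modulus. -/
theorem valueAtOne_regularFactor : valueAtOne regularFactor = 1 := by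
  have ha := norm_singularPoint_lt_one
  have ha' : ‖star singularPoint‖ < 1 := by rwa [norm_star]
  have hh : ‖(1 / 2 : ℂ)‖ < 1 := by norm_num
  have hv : valueAtOne regularFactor = valueAtOne (invSqrtSeries (1 / 2)) *
      (valueAtOne (invSqrtSeries singularPoint) *
        valueAtOne (invSqrtSeries (star singularPoint))) := by
    rw [regularFactor, valueAtOne_mul (weightSummable_invSqrtSeries hh)
      ((weightSummable_invSqrtSeries ha).mul (weightSummable_invSqrtSeries ha')),
      valueAtOne_mul (weightSummable_invSqrtSeries ha) (weightSummable_invSqrtSeries ha')]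
  obtain ⟨t, ht0, ht⟩ : ∃ t : ℝ, 0 ≤ t ∧ valueAtOne (invSqrtSeries (1 / 2)) = t := by
    refine ⟨∑' n : ℕ, binomRatio n * (1 / 2) ^ n,
      tsum_nonneg fun n => mul_nonneg (binomRatio_pos n).le (by positivity), ?_⟩
    rw [Complex.ofReal_tsum, valueAtOne]
    refine tsum_congr fun n => ?_
    simp [invSqrtSeries]
  have hreal : valueAtOne regularFactor =
      ((t * Complex.normSq (valueAtOne (invSqrtSeries singularPoint)) : ℝ) : ℂ) := by
    rw [hv, ht, valueAtOne_invSqrtSeries_star, Complex.ofReal_mul, ← Complex.mul_conj]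
    rfl
  have hsq : valueAtOne regularFactor ^ 2 = 1 := by
    have h1 := valueAtOne_invSqrtSeries_sq hh
    have h2 := valueAtOne_invSqrtSeries_sq ha
    have h3 := valueAtOne_invSqrtSeries_sq ha'
    have h4 : (1 - singularPoint) * (1 - star singularPoint) = 2 := by
      linear_combination singularPoint_mul_conj - singularPoint_add_conj
    have h5 : valueAtOne regularFactor ^ 2 *
        ((1 - 1 / 2) * ((1 - singularPoint) * (1 - star singularPoint))) = 1 := by
      rw [hv]
      linear_combination (valueAtOne (invSqrtSeries singularPoint) ^ 2 * (1 - singularPoint)) *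
        (valueAtOne (invSqrtSeries (star singularPoint)) ^ 2 * (1 - star singularPoint)) * h1 +
        (valueAtOne (invSqrtSeries (star singularPoint)) ^ 2 * (1 - star singularPoint)) * h2 + h3
    rw [h4] at h5
    linear_combination h5
  rw [hreal] at hsq ⊢
  have h6 : (t * Complex.normSq (valueAtOne (invSqrtSeries singularPoint))) ^ 2 = 1 := by
    exact_mod_cast hsq
  rw [(pow_eq_one_iff_of_nonneg (mul_nonneg ht0 (Complex.normSq_nonneg _)) two_ne_zero).1 h6,
    Complex.ofReal_one]

/-! ### Assembling the asymptotics -/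

/-- The generating function of `2 * winCount n + 1`. -/
noncomputable def winSeries : ℂ⟦X⟧ :=
  invSqrtSeries 2 * (invSqrtSeries 1 *
    (invSqrtSeries (2 * singularPoint) * invSqrtSeries (2 * star singularPoint)))

theorem winSeries_sq : winSeries ^ 2 * ((1 - X) * (1 - X - 4 * X ^ 3)) = 1 := by
  have h1 := invSqrtSeries_sq 2
  have h2 := invSqrtSeries_sq 1
  have h3 := invSqrtSeries_sq (2 * singularPoint)
  have h4 := invSqrtSeries_sq (2 * star singularPoint)
  have hs : C (2 * singularPoint) + C (2 * star singularPoint) = (-1 : ℂ⟦X⟧) := by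
    rw [← map_add, ← mul_add, singularPoint_add_conj]
    norm_num
  have hp : C (2 * singularPoint) * C (2 * star singularPoint) = (2 : ℂ⟦X⟧) := by
    rw [← map_mul, mul_mul_mul_comm, singularPoint_mul_conj, ← map_ofNat (C (R := ℂ)) 2]
    norm_num
  have h5 : (1 - C (2 * singularPoint) * X) * (1 - C (2 * star singularPoint) * X) =
      (1 + X + 2 * X ^ 2 : ℂ⟦X⟧) := by
    linear_combination X ^ 2 * hp - X * hs
  rw [map_ofNat] at h1
  rw [map_one] at h2
  have h6 : ((1 - X) * (1 - X - 4 * X ^ 3) : ℂ⟦X⟧) = (1 - 2 * X) * ((1 - 1 * X) *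
      ((1 - C (2 * singularPoint) * X) * (1 - C (2 * star singularPoint) * X))) := by
    rw [h5]; ring
  rw [h6, winSeries]
  calc _ = (invSqrtSeries 2 ^ 2 * (1 - 2 * X)) * ((invSqrtSeries 1 ^ 2 * (1 - 1 * X)) *
        ((invSqrtSeries (2 * singularPoint) ^ 2 * (1 - C (2 * singularPoint) * X)) *
        (invSqrtSeries (2 * star singularPoint) ^ 2 * (1 - C (2 * star singularPoint) * X)))) := by
          ring
    _ = 1 := by rw [h1, h2, h3, h4]; simp

theorem two_mul_winDiff (n : ℕ) :
    2 * (winDiff n : ℂ) = coeff n (invSqrtSeries 1 * regularFactor) - ((1 / 2 : ℝ) ^ n : ℝ) := by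
  have h0 : constantCoeff winSeries = 1 := by
    simp [winSeries, constantCoeff_invSqrtSeries]
  -- Division by 2ⁿ moves the dominant singularity from 1/2 to 1.
  have hr : rescale (1 / 2 : ℂ) winSeries = invSqrtSeries 1 * regularFactor := by
    simp only [winSeries, regularFactor, map_mul, rescale_invSqrtSeries]
    norm_num
    left; left
    congr 2 <;> ring
  rw [← hr, coeff_rescale, ← winCount_eq_coeff winSeries_sq h0, winDiff_eq]
  push_cast
  rw [one_div, inv_pow]
  field_simp
  ring

theorem winDiff_bound : ∃ K : ℝ, 0 ≤ K ∧ ∀ n : ℕ,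
    |2 * winDiff n - binomRatio n| ≤ K * errScale n + (1 / 2) ^ n := by
  refine ⟨∑' j : ℕ, ((j : ℝ) + 1) ^ 3 * ‖coeff j regularFactor‖,
    tsum_nonneg fun j => by positivity, fun n => ?_⟩
  have h := norm_coeff_invSqrtSeries_one_mul_sub_le weightSummable_regularFactor n
  rw [valueAtOne_regularFactor, mul_one] at h
  have e : ((2 * winDiff n - binomRatio n : ℝ) : ℂ) =
      (coeff n (invSqrtSeries 1 * regularFactor) - binomRatio n) -
        ((1 / 2 : ℝ) ^ n : ℝ) := by
    push_cast
    have := two_mul_winDiff n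
    push_cast at this
    rw [this]
    ring
  rw [← Real.norm_eq_abs, ← Complex.norm_real, e]
  refine (norm_sub_le _ _).trans (add_le_add h ?_)
  rw [Complex.norm_real, Real.norm_of_nonneg (by positivity)]

end CoinGame

theorem mainTheorem4 :
    (fun n : ℕ => CoinGame.winDiff n - 1 / (2 * Real.sqrt ((n : ℝ) * Real.pi)))
      =O[atTop] (fun n : ℕ => (n : ℝ) ^ (-(3 / 2) : ℝ)) := by
  obtain ⟨K, hK, h⟩ := CoinGame.winDiff_bound
  have ht := tendsto_pow_const_mul_const_pow_of_abs_lt_one 2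
    (r := (1 / 2 : ℝ)) (by rw [abs_of_pos] <;> norm_num)
  refine IsBigO.of_bound (K + 2) ?_
  filter_upwards [ht.eventually_le_const one_pos, eventually_gt_atTop 0] with n h2 hn
  have hn' : (1 : ℝ) ≤ n := by exact_mod_cast hn
  have hpos : (0 : ℝ) < n := by linarith
  have h1 := h n
  have h3 := CoinGame.abs_binomRatio_sub_le hn
  have h4 : CoinGame.errScale n ≤ (n : ℝ) ^ (-(3 / 2) : ℝ) :=
    Real.rpow_le_rpow_of_nonpos hpos (by linarith) (by norm_num)
  have h5 : (1 / 2 : ℝ) ^ n ≤ (n : ℝ) ^ (-(3 / 2) : ℝ) := by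
    have h6 : (n : ℝ) ^ (-2 : ℝ) ≤ (n : ℝ) ^ (-(3 / 2) : ℝ) :=
      Real.rpow_le_rpow_of_exponent_le hn' (by norm_num)
    refine le_trans ?_ h6
    rw [Real.rpow_neg hpos.le, Real.rpow_two, ← one_div, le_div_iff₀ (by positivity)]
    linarith
  have hw : (0 : ℝ) ≤ (n : ℝ) ^ (-(3 / 2) : ℝ) := by positivity
  have h7 := mul_le_mul_of_nonneg_left h4 hK
  have e : CoinGame.winDiff n - 1 / (2 * Real.sqrt ((n : ℝ) * Real.pi)) =
      ((2 * CoinGame.winDiff n - CoinGame.binomRatio n) +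
        (CoinGame.binomRatio n - 1 / Real.sqrt ((n : ℝ) * Real.pi))) / 2 := by
    rw [mul_comm 2 (Real.sqrt _), ← div_div]
    ring
  rw [Real.norm_of_nonneg hw, Real.norm_eq_abs, e, abs_div, abs_two]
  have h8 := abs_add_le (2 * CoinGame.winDiff n - CoinGame.binomRatio n)
    (CoinGame.binomRatio n - 1 / Real.sqrt ((n : ℝ) * Real.pi))
  have h9 := mul_nonneg hK hw
  rw [div_le_iff₀ two_pos]
  linarith
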